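/- Let $X$ be a compact connected Riemann surface with canonical bundle $K$. Let $p_1,\dots,p_N$, $q_1,\dots,q_m$, $\check q_1,\dots,\check q_n$, $\check q_{0,1},\dots,\check q_{0,\delta}$ be distinct points of $X$ (any of the numbers $N,m,n,\delta$ may be $0$), with local coordinates $w_r$, $z_i$, $\check z_j$, $\check z_{0,l}$, each centred at its point and defined on open neighbourhoods of these points that are pairwise disjoint, and let $X_0$ be the complement of all these points. Put $L=\mathcal O_X(\sum_i q_i-\sum_j\check q_j)$ and $\Lambda=\mathcal O_X(\sum_l \check q_{0,l})$ (so $\Lambda=\mathcal O_X$ for $\delta=0$ and $\Lambda=\mathcal O_X(\check q_0)$ for $\delta=1$). For $\mathbf x=(x_1,\dots,x_N)\in\mathbb C^N$ let $E$ be the holomorphic rank-2 bundle with determinant $\Lambda$ and subbundle $L$ (spanned by the first frame vectors) whose transition matrices from $X_0$ to the neighbourhoods of $p_r$, $q_i$, $\check q_j$, $\check q_{0,l}$ are $$\begin{pmatrix}1&x_r/w_r\\0&1\end{pmatrix},\quad \begin{pmatrix}z_i&0\\0&z_i^{-1}\end{pmatrix},\quad \begin{pmatrix}\check z_j^{-1}&0\\0&\check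 z_j\end{pmatrix},\quad \begin{pmatrix}1&0\\0&\check z_{0,l}\end{pmatrix}.$$ A Higgs field is an element $\phi\in H^0(\mathrm{End}_0(E)\otimes K)$; the Higgs differential representing it is its matrix $\begin{pmatrix}\phi_0&\phi_-\\\phi_+&-\phi_0\end{pmatrix}$ in the frame of $E$ over $X_0$. Let $c_{\mathbf x}:H^0(\mathrm{End}_0(E)\otimes K)\to H^0(KL^{-2}\Lambda)$ send $\phi$ to the composition $L\hookrightarrow E\xrightarrow{\phi}E\otimes K\to L^{-1}\Lambda K$, i.e. to its lower-left component. Let $s\in\mathrm{im}(c_{\mathbf x})$, $s\neq0$, let $\mathbf u$ be the zero divisor of $s$, let $\phi_+$ be the meromorphic differential that represents $s$ over $X_0$, and let $k_r=\phi_+(p_r)$ in the coordinate $w_r$. Denote by $\mathcal H_{\mathbf x,\mathbf k}$ the set of Higgs differentials on $E$ with lower-left component $\phi_+$, by $\Omega_{\mathbf x,\mathbf k}$ the set of meromorphic differentials $\omega_0$ on $X$ that are holomorphic away from $p_1,\dots,p_N$, have at most simple poles at these points, and satisfy $\mathrm{Res}_{p_r}\omega_0=-x_rk_r$ for all $r$,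 and by $\Pi_{\mathbf x,\mathbf k}:\mathcal H_{\mathbf x,\mathbf k}\to\Omega_{\mathbf x,\mathbf k}$ the map sending a Higgs differential to its diagonal component $\phi_0$. Let $$Q_{-\mathbf u}=\{0\}\cup\{q\in H^0(X,K^2): \mathrm{div}(q)\ge\mathbf u\}.$$ Then multiplication by $s$, $\psi\mapsto s\psi$, is a linear isomorphism $H^0(KL^2\Lambda^{-1})\to Q_{-\mathbf u}$. Moreover, if $\omega_0\in\Omega_{\mathbf x,\mathbf k}$ lies in the image of $\Pi_{\mathbf x,\mathbf k}$, then its preimage $\Pi_{\mathbf x,\mathbf k}^{-1}(\omega_0)$ is an affine space modeled on the vector space $Q_{-\mathbf u}$, where for $\psi\in H^0(KL^2\Lambda^{-1})$ the element $s\psi\in Q_{-\mathbf u}$ acts by adding to a Higgs differential the strictly upper triangular matrix whose upper-right entry is the meromorphic differential representing $\psi$ over $X_0$. -/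

import Mathlib

open scoped Manifold ContDiff Topology

noncomputable section

namespace HiggsDifferential

section Differentials

variable {X : Type*} [TopologicalSpace X] [ChartedSpace ℂ X]

variable (X) in
/-- Complex valued functions on the tangent bundle of the Riemann surface `X`. A section of the
`k`-th power `K ^ k` of the canonical bundle is such a function that is homogeneous of degree `k`
on every tangent line, and the product of sections of `K ^ k` and `K ^ l` is the pointwise product
of functions. -/
abbrev TangentFun : Type _ := (x : X) → TangentSpace 𝓘(ℂ) x → ℂ

variable (X) in
/-- Functions on the tangent bundle with values in `2 × 2` matrices. -/
abbrev TangentMat : Type _ := (x : X) → TangentSpace 𝓘(ℂ) x → Matrix (Fin 2) (Fin 2) ℂ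

/-- The matrix entry `(i, j)`. -/
def entry (i j : Fin 2) (φ : TangentMat X) : TangentFun X := fun x v => φ x v i j

/-- The strictly upper triangular matrix with upper right entry `ψ`. -/
def upperRight (ψ : TangentFun X) : TangentMat X := fun x v => !![0, ψ x v; 0, 0]

/-- The function `f` such that `η = f dz ^ k` in the local coordinate `z` given by the chart `e`:
evaluate `η` on the coordinate vector field `∂ / ∂z`. -/
def coeff (e : OpenPartialHomeomorph X ℂ) (η : TangentFun X) (z : ℂ) : ℂ :=
  η (e.symm z) (mfderiv 𝓘(ℂ) 𝓘(ℂ) e.symm z (1 : ℂ))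

/-- The space `H⁰(U, K ^ k)` of holomorphic `k`-differentials on an open subset `U` of `X`
(`k = 1`: holomorphic one-forms, `k = 2`: holomorphic quadratic differentials). A differential
that is only defined on `U` is represented by its extension by zero to `X`. -/
def holDiff (k : ℕ) (U : Set X) : Submodule ℂ (TangentFun X) where
  carrier := {η |
    (∀ x (c : ℂ) (v : TangentSpace 𝓘(ℂ) x), η x (c • v) = c ^ k * η x v) ∧
    (∀ x ∈ U, ∀ e ∈ IsManifold.maximalAtlas 𝓘(ℂ) ω X, x ∈ e.source →
      AnalyticAt ℂ (coeff e η) (e x)) ∧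
    (∀ x ∉ U, ∀ v, η x v = 0)}
  add_mem' := by
    rintro a b ⟨ha, ha', ha''⟩ ⟨hb, hb', hb''⟩
    refine ⟨fun x c v => ?_, fun x hx e he hxe => ?_, fun x hx v => ?_⟩
    · simp only [Pi.add_apply, ha, hb]; ring
    · exact (ha' x hx e he hxe).add (hb' x hx e he hxe)
    · simp [ha'' x hx, hb'' x hx]
  zero_mem' := ⟨fun x c v => by simp, fun x _ e _ _ => analyticAt_const, fun x _ v => rfl⟩
  smul_mem' := by
    rintro c a ⟨ha, ha', ha''⟩
    refine ⟨fun x d v => ?_, fun x hx e he hxe => ?_, fun x hx v => ?_⟩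
    · simp only [Pi.smul_apply, ha, smul_eq_mul]; ring
    · exact analyticAt_const.mul (ha' x hx e he hxe)
    · simp [ha'' x hx]

/-- The order of vanishing at `x` of a holomorphic differential (`⊤` if it vanishes identically
near `x`). -/
def ordAt (η : TangentFun X) (x : X) : ℕ∞ :=
  analyticOrderAt (coeff (chartAt ℂ x) η) (chartAt ℂ x x)

/-- `Q_{-D}`, the space of holomorphic quadratic differentials on `X` that are zero or whose
divisor is at least `D`. -/
def quadDiff [IsManifold 𝓘(ℂ) ω X] (D : X → ℕ∞) : Submodule ℂ (TangentFun X) where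
  carrier := {q | q ∈ holDiff 2 (Set.univ : Set X) ∧ (q = 0 ∨ ∀ x, D x ≤ ordAt q x)}
  add_mem' := by
    rintro a b ⟨ha, ha'⟩ ⟨hb, hb'⟩
    refine ⟨add_mem ha hb, ?_⟩
    rcases ha' with rfl | ha'
    · simpa using hb'
    rcases hb' with rfl | hb'
    · right; simpa using ha'
    exact Or.inr fun x => (le_min (ha' x) (hb' x)).trans le_analyticOrderAt_add
  zero_mem' := ⟨zero_mem _, Or.inl rfl⟩
  smul_mem' := by
    rintro c a ⟨ha, ha'⟩
    refine ⟨Submodule.smul_mem _ c ha, ?_⟩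
    rcases ha' with rfl | ha'
    · left; simp
    refine Or.inr fun x => (ha' x).trans ?_
    have h1 : AnalyticAt ℂ (fun _ : ℂ => c) (chartAt ℂ x x) := analyticAt_const
    have h2 := ha.2.1 x trivial _ (IsManifold.chart_mem_maximalAtlas x) (mem_chart_source ℂ x)
    have h4 : ordAt (c • a) x
        = analyticOrderAt ((fun _ : ℂ => c) * coeff (chartAt ℂ x) a) (chartAt ℂ x x) := rfl
    rw [h4, analyticOrderAt_mul h1 h2]
    exact le_add_self

end Differentials

/-- Indices of the special points: the points `p_r`, `q_i`, `q̌_j` of the reference divisors `𝐩`,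
`𝐪`, `𝐪̌`, and the points of the divisor of `Λ` (one point `q̌_0` if `Λ = 𝒪(q̌_0)`, none if
`Λ = 𝒪`). -/
inductive Idx (N m n δ : ℕ) : Type
  | p (r : Fin N)
  | q (i : Fin m)
  | qc (j : Fin n)
  | q0 (l : Fin δ)

/-- The reference divisors and local coordinates: distinct points of `X`, each with a local
coordinate on an open neighbourhood, where these neighbourhoods do not intersect each other. The
numbers of points are arbitrary, and no genericity of the divisors is needed. -/
structure RefData (X : Type*) [TopologicalSpace X] [ChartedSpace ℂ X] (N m n δ : ℕ) where
  pt : Idx N m n δ → X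
  chart : Idx N m n δ → OpenPartialHomeomorph X ℂ
  chart_mem : ∀ α, chart α ∈ IsManifold.maximalAtlas 𝓘(ℂ) ω X
  pt_mem : ∀ α, pt α ∈ (chart α).source
  disjoint : ∀ α β, α ≠ β → Disjoint (chart α).source (chart β).source

namespace RefData

variable {X : Type*} [TopologicalSpace X] [ChartedSpace ℂ X] {N m n δ : ℕ}
  (D : RefData X N m n δ)

/-- `X₀`, the complement of the special points. -/
def X0 : Set X := {x | ∀ α, x ≠ D.pt α}

/-- The open cover of `X` by `X₀` (index `none`) and the neighbourhoods of the special points. -/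
def cover : Option (Idx N m n δ) → Set X
  | none => D.X0
  | some α => (D.chart α).source

/-- The local coordinate `z - z(pt)` centred at a special point. -/
def t (α : Idx N m n δ) (y : X) : ℂ := D.chart α y - D.chart α (D.pt α)

/-- The transition matrices of the rank two bundle `E = E_{𝐪,𝐱}` from `X₀` to the neighbourhoods of
the special points. -/
def gE (x : Fin N → ℂ) : Idx N m n δ → X → Matrix (Fin 2) (Fin 2) ℂ
  | .p r, y => !![1, x r / D.t (.p r) y; 0, 1]
  | .q i, y => !![D.t (.q i) y, 0; 0, (D.t (.q i) y)⁻¹]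
  | .qc j, y => !![(D.t (.qc j) y)⁻¹, 0; 0, D.t (.qc j) y]
  | .q0 l, y => !![1, 0; 0, D.t (.q0 l) y]

/-- The transition functions of the subbundle `L = 𝒪(𝐪 - 𝐪̌)` of `E`, which is spanned by the
first vector of each local frame. -/
def gL : Idx N m n δ → X → ℂ
  | .p _, _ => 1
  | .q i, y => D.t (.q i) y
  | .qc j, y => (D.t (.qc j) y)⁻¹
  | .q0 _, _ => 1

/-- The transition functions of `Λ = det E`. -/
def gΛ : Idx N m n δ → X → ℂ
  | .p _, _ => 1
  | .q _, _ => 1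
  | .qc _, _ => 1
  | .q0 l, y => D.t (.q0 l) y

/-- `H⁰(K ^ k ⊗ M)` for the line bundle `M` on `X` with transition functions `ℓ` from `X₀` to the
neighbourhoods of the special points: families of local holomorphic `k`-differentials, one on
each set of the cover, related by `ℓ` on the overlaps. -/
def sections (k : ℕ) (ℓ : Idx N m n δ → X → ℂ) :
    Submodule ℂ (Option (Idx N m n δ) → TangentFun X) where
  carrier := {s |
    (∀ i, s i ∈ holDiff k (D.cover i)) ∧
    (∀ α, ∀ y ∈ D.X0 ∩ (D.chart α).source, ∀ v, s (some α) y v = ℓ α y * s none y v)}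
  add_mem' := by
    rintro a b ⟨ha, ha'⟩ ⟨hb, hb'⟩
    refine ⟨fun i => add_mem (ha i) (hb i), fun α y hy v => ?_⟩
    simp only [Pi.add_apply, ha' α y hy v, hb' α y hy v]; ring
  zero_mem' := ⟨fun i => zero_mem _, fun α y hy v => by simp⟩
  smul_mem' := by
    rintro c a ⟨ha, ha'⟩
    refine ⟨fun i => Submodule.smul_mem _ c (ha i), fun α y hy v => ?_⟩
    simp only [Pi.smul_apply, ha' α y hy v, smul_eq_mul]; ring

/-- `H⁰(K L⁻² Λ)`. -/
abbrev lowerSections : Submodule ℂ (Option (Idx N m n δ) → TangentFun X) :=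
  D.sections 1 fun α y => (D.gL α y ^ 2)⁻¹ * D.gΛ α y

/-- `H⁰(K L² Λ⁻¹)`. -/
abbrev upperSections : Submodule ℂ (Option (Idx N m n δ) → TangentFun X) :=
  D.sections 1 fun α y => D.gL α y ^ 2 * (D.gΛ α y)⁻¹

/-- The zero divisor of a section: its order of vanishing at every point, computed in any local
frame (on overlaps of the cover all the orders agree). -/
def zeroDivisor (s : Option (Idx N m n δ) → TangentFun X) (y : X) : ℕ∞ :=
  ⨆ i : {i // y ∈ D.cover i}, ordAt (s i) y

/-- The space `H⁰(End₀(E) ⊗ K)` of Higgs fields on `E`: families of trace-free matrices of local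
holomorphic one-forms, conjugated by the transition matrices on the overlaps. -/
def higgsFields (x : Fin N → ℂ) : Submodule ℂ (Option (Idx N m n δ) → TangentMat X) where
  carrier := {Φ |
    (∀ i a b, entry a b (Φ i) ∈ holDiff 1 (D.cover i)) ∧
    (∀ i y v, (Φ i y v).trace = 0) ∧
    (∀ α, ∀ y ∈ D.X0 ∩ (D.chart α).source, ∀ v,
      Φ (some α) y v = D.gE x α y * Φ none y v * (D.gE x α y)⁻¹)}
  add_mem' := by
    rintro a b ⟨ha, ha', ha''⟩ ⟨hb, hb', hb''⟩
    refine ⟨fun i k l => add_mem (ha i k l) (hb i k l), fun i y v => ?_, fun α y hy v => ?_⟩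
    · simp [ha' i y v, hb' i y v]
    · simp only [Pi.add_apply, ha'' α y hy v, hb'' α y hy v]; noncomm_ring
  zero_mem' := ⟨fun i k l => zero_mem (holDiff 1 (D.cover i)), fun i y v => by simp,
    fun α y hy v => by simp⟩
  smul_mem' := by
    rintro c a ⟨ha, ha', ha''⟩
    refine ⟨fun i k l => Submodule.smul_mem _ c (ha i k l), fun i y v => ?_, fun α y hy v => ?_⟩
    · simp [ha' i y v]
    · simp only [Pi.smul_apply, ha'' α y hy v]; simp

lemma t_ne_zero {α : Idx N m n δ} {y : X} (hy : y ∈ D.X0 ∩ (D.chart α).source) :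
    D.t α y ≠ 0 := fun h =>
  hy.1 α ((D.chart α).injOn hy.2 (D.pt_mem α) (sub_eq_zero.mp h))

/-- Lower left entries transform like sections of `K L⁻² Λ`. -/
lemma conj_lower (x : Fin N → ℂ) (α : Idx N m n δ) {y : X}
    (hy : y ∈ D.X0 ∩ (D.chart α).source) (M : Matrix (Fin 2) (Fin 2) ℂ) :
    (D.gE x α y * M * (D.gE x α y)⁻¹) 1 0 = (D.gL α y ^ 2)⁻¹ * D.gΛ α y * M 1 0 := by
  have ht := D.t_ne_zero hy
  cases α <;>
    simp [gE, gL, gΛ, Matrix.inv_def, Matrix.adjugate_fin_two, Matrix.mul_apply,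
      Fin.sum_univ_two, Matrix.det_fin_two, Matrix.vecMul, Matrix.vecHead, Matrix.vecTail, ht] <;>
    try field_simp

/-- Upper left entries of the conjugated matrices. -/
lemma conj_diag (x : Fin N → ℂ) (α : Idx N m n δ) {y : X}
    (hy : y ∈ D.X0 ∩ (D.chart α).source) (M : Matrix (Fin 2) (Fin 2) ℂ) :
    (D.gE x α y * M * (D.gE x α y)⁻¹) 0 0 =
      M 0 0 + (match α with | .p r => x r / D.t (.p r) y | _ => 0) * M 1 0 := by
  have ht := D.t_ne_zero hy
  cases α <;>
    simp [gE, Matrix.inv_def, Matrix.adjugate_fin_two, Matrix.mul_apply,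
      Fin.sum_univ_two, Matrix.det_fin_two, Matrix.vecMul, Matrix.vecHead, Matrix.vecTail, ht] <;>
    try field_simp

/-- The map `c_𝐱 : H⁰(End₀(E) ⊗ K) → H⁰(K L⁻² Λ)`, sending `φ` to the composition
`L ↪ E → E ⊗ K → L⁻¹ Λ K`: in the local frames this is the lower left component. -/
def c (x : Fin N → ℂ) : D.higgsFields x →ₗ[ℂ] D.lowerSections where
  toFun Φ := ⟨fun i => entry 1 0 (Φ.1 i), fun i => Φ.2.1 i 1 0, fun α y hy v => by
    simp only [entry, Φ.2.2.2 α y hy v]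
    exact D.conj_lower x α hy _⟩
  map_add' _ _ := rfl
  map_smul' _ _ := rfl

/-- The space of Higgs differentials on `E`: the matrices of differentials on `X₀` (extended by
zero to the special points) that represent a Higgs field in the frame of `E` over `X₀`. -/
def higgsDifferentials (x : Fin N → ℂ) : Submodule ℂ (TangentMat X) :=
  (D.higgsFields x).map (LinearMap.proj none)

/-- `ℋ_{𝐱,𝐤}`: the Higgs differentials whose lower left component is the differential `ϕ₊` on `X₀`
that corresponds to the section `s` of `K L⁻² Λ`. -/
def H (x : Fin N → ℂ) (s : D.lowerSections) : Set (TangentMat X) :=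
  {φ | φ ∈ D.higgsDifferentials x ∧ entry 1 0 φ = s.1 none}

/-- `Ω_𝐩`: the abelian differentials that are holomorphic outside the points `p_r` and have at
most simple poles there. A differential is represented by its restriction to `X₀`. -/
def Ωp : Set (TangentFun X) :=
  {η | η ∈ holDiff 1 D.X0 ∧ ∀ α,
    MeromorphicAt (coeff (D.chart α) η) (D.chart α (D.pt α)) ∧
    (match α with | .p _ => (-1 : WithTop ℤ) | _ => 0) ≤
      meromorphicOrderAt (coeff (D.chart α) η) (D.chart α (D.pt α))}

/-- The residue at a special point of a differential with at most a simple pole there is `ρ`. -/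
def HasResidue (η : TangentFun X) (α : Idx N m n δ) (ρ : ℂ) : Prop :=
  Filter.Tendsto (fun z => (z - D.chart α (D.pt α)) * coeff (D.chart α) η z)
    (𝓝[≠] (D.chart α (D.pt α))) (𝓝 ρ)

/-- `k_r = ϕ₊(p_r)`, the value at `p_r` in the local coordinate of the differential `ϕ₊`
corresponding to `s`. Near `p_r` the frames of `K L⁻² Λ` over `X₀` and over the neighbourhood of
`p_r` agree, so this is the value of the local representative of `s`. -/
def kval (s : D.lowerSections) (r : Fin N) : ℂ :=
  coeff (D.chart (.p r)) (s.1 (some (.p r))) (D.chart (.p r) (D.pt (.p r)))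

/-- `Ω_{𝐱,𝐤}`: the differentials in `Ω_𝐩` whose residue at `p_r` is `- x_r k_r` for every `r`. -/
def Ωxk (x : Fin N → ℂ) (s : D.lowerSections) : Set (TangentFun X) :=
  {η | η ∈ D.Ωp ∧ ∀ r, D.HasResidue η (.p r) (-(x r * D.kval s r))}

/-- The punctured neighbourhood of a special point lies in `X₀`. -/
lemma eventually_mem (α : Idx N m n δ) : ∀ᶠ z in 𝓝[≠] (D.chart α (D.pt α)),
    (D.chart α).symm z ∈ D.X0 ∩ (D.chart α).source ∧ D.chart α ((D.chart α).symm z) = z := by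
  have h := (D.chart α).open_target.mem_nhds ((D.chart α).map_source (D.pt_mem α))
  filter_upwards [nhdsWithin_le_nhds h, self_mem_nhdsWithin] with z hz hne
  have hs := (D.chart α).map_target hz
  refine ⟨⟨fun β hβ => ?_, hs⟩, (D.chart α).right_inv hz⟩
  by_cases hαβ : α = β
  · subst hαβ
    apply hne
    rw [Set.mem_singleton_iff, ← hβ, (D.chart α).right_inv hz]
  · exact Set.disjoint_left.mp (D.disjoint α β hαβ) hs (hβ ▸ D.pt_mem β)

/-- The diagonal component of a Higgs differential in `ℋ_{𝐱,𝐤}` lies in `Ω_{𝐱,𝐤}`. -/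
lemma diag_mem (x : Fin N → ℂ) (s : D.lowerSections) {φ : TangentMat X} (hφ : φ ∈ D.H x s) :
    entry 0 0 φ ∈ D.Ωxk x s := by
  obtain ⟨⟨Φ, hΦ, rfl⟩, hs⟩ := hφ
  change entry 1 0 (Φ none) = s.1 none at hs
  change entry 0 0 (Φ none) ∈ D.Ωxk x s
  -- near a special point, the diagonal entry equals a holomorphic function minus the polar part
  have key : ∀ α, ∀ᶠ z in 𝓝[≠] (D.chart α (D.pt α)),
      coeff (D.chart α) (entry 0 0 (Φ none)) z =
        coeff (D.chart α) (entry 0 0 (Φ (some α))) z -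
        (match α with | .p r => x r / (z - D.chart (.p r) (D.pt (.p r))) | _ => 0) *
          coeff (D.chart α) (s.1 none) z := by
    intro α
    filter_upwards [D.eventually_mem α] with z hz
    rw [← hs]
    simp only [coeff, entry]
    rw [hΦ.2.2 α _ hz.1, D.conj_diag x α hz.1]
    cases α with
    | p r => simp only [t]; rw [hz.2]; ring
    | q r => simp
    | qc r => simp
    | q0 r => simp
  have hol : ∀ α a b, AnalyticAt ℂ (coeff (D.chart α) (entry a b (Φ (some α))))
      (D.chart α (D.pt α)) := fun α a b =>
    (hΦ.1 (some α) a b).2.1 _ (D.pt_mem α) _ (D.chart_mem α) (D.pt_mem α)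
  have key0 : ∀ α, (∀ r, α ≠ .p r) →
      coeff (D.chart α) (entry 0 0 (Φ none)) =ᶠ[𝓝[≠] (D.chart α (D.pt α))]
        coeff (D.chart α) (entry 0 0 (Φ (some α))) := by
    intro α hα
    filter_upwards [key α] with z hz
    rw [hz]
    cases α with
    | p r => exact absurd rfl (hα r)
    | q r => simp
    | qc r => simp
    | q0 r => simp
  have keyp : ∀ r, coeff (D.chart (.p r)) (entry 0 0 (Φ none))
      =ᶠ[𝓝[≠] (D.chart (.p r) (D.pt (.p r)))]
        coeff (D.chart (.p r)) (entry 0 0 (Φ (some (.p r)))) +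
        (fun z => z - D.chart (.p r) (D.pt (.p r)))⁻¹ *
          ((fun _ => -x r) * coeff (D.chart (.p r)) (s.1 (some (.p r)))) := by
    intro r
    filter_upwards [key (.p r), D.eventually_mem (.p r)] with z hz hz'
    rw [hz]
    have h1 : coeff (D.chart (.p r)) (s.1 (some (.p r))) z
        = coeff (D.chart (.p r)) (s.1 none) z := by
      simp only [coeff]
      rw [s.2.2 (.p r) _ hz'.1]
      simp [gL, gΛ]
    simp only [Pi.add_apply, Pi.mul_apply, Pi.inv_apply, h1]
    ring
  have hsp : ∀ r, AnalyticAt ℂ (coeff (D.chart (.p r)) (s.1 (some (.p r))))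
      (D.chart (.p r) (D.pt (.p r))) := fun r =>
    (s.2.1 (some (.p r))).2.1 _ (D.pt_mem _) _ (D.chart_mem _) (D.pt_mem _)
  have hinv : ∀ r, MeromorphicAt (fun z => z - D.chart (.p r) (D.pt (.p r)))⁻¹
      (D.chart (.p r) (D.pt (.p r))) := fun r => by
    have : AnalyticAt ℂ (fun z => z - D.chart (.p r) (D.pt (.p r)))
      (D.chart (.p r) (D.pt (.p r))) := by fun_prop
    exact this.meromorphicAt.inv
  have hprod : ∀ r, AnalyticAt ℂ ((fun _ => -x r) * coeff (D.chart (.p r)) (s.1 (some (.p r))))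
      (D.chart (.p r) (D.pt (.p r))) := fun r => analyticAt_const.mul (hsp r)
  refine ⟨⟨hΦ.1 none 0 0, fun α => ?_⟩, fun r => ?_⟩
  · by_cases hα : ∀ r, α ≠ .p r
    · have h0 := key0 α hα
      refine ⟨(hol α 0 0).meromorphicAt.congr h0.symm, ?_⟩
      rw [meromorphicOrderAt_congr h0]
      cases α with
      | p r => exact absurd rfl (hα r)
      | q r => exact (hol _ 0 0).meromorphicOrderAt_nonneg
      | qc r => exact (hol _ 0 0).meromorphicOrderAt_nonneg
      | q0 r => exact (hol _ 0 0).meromorphicOrderAt_nonneg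
    · push Not at hα
      obtain ⟨r, rfl⟩ := hα
      have h0 := keyp r
      refine ⟨((hol _ 0 0).meromorphicAt.add
        ((hinv r).mul (hprod r).meromorphicAt)).congr h0.symm, ?_⟩
      rw [meromorphicOrderAt_congr h0]
      refine le_trans (le_min ?_ ?_) (meromorphicOrderAt_add (hol _ 0 0).meromorphicAt
        ((hinv r).mul (hprod r).meromorphicAt))
      · exact le_trans (show (-1 : WithTop ℤ) ≤ 0 by decide) (hol _ 0 0).meromorphicOrderAt_nonneg
      · rw [meromorphicOrderAt_mul (hinv r) (hprod r).meromorphicAt, meromorphicOrderAt_inv,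
          meromorphicOrderAt_id_sub_const]
        exact le_add_of_nonneg_right (hprod r).meromorphicOrderAt_nonneg
  · have hcont : Filter.Tendsto (fun z => (z - D.chart (.p r) (D.pt (.p r))) *
        coeff (D.chart (.p r)) (entry 0 0 (Φ (some (.p r)))) z +
        (-x r) * coeff (D.chart (.p r)) (s.1 (some (.p r))) z)
        (𝓝[≠] (D.chart (.p r) (D.pt (.p r)))) (𝓝 (-(x r * D.kval s r))) := by
      have c1 := (hol (.p r) 0 0).continuousAt
      have c2 := (hsp r).continuousAt
      have c3 : ContinuousAt (fun z => (z - D.chart (.p r) (D.pt (.p r))) *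
        coeff (D.chart (.p r)) (entry 0 0 (Φ (some (.p r)))) z +
        (-x r) * coeff (D.chart (.p r)) (s.1 (some (.p r))) z)
        (D.chart (.p r) (D.pt (.p r))) := by fun_prop
      have c4 := c3.tendsto.mono_left (nhdsWithin_le_nhds (s := {D.chart (.p r) (D.pt (.p r))}ᶜ))
      convert c4 using 2
      simp [kval]
    refine hcont.congr' ?_
    filter_upwards [keyp r, self_mem_nhdsWithin] with z hz hne
    rw [hz]
    have : z - D.chart (.p r) (D.pt (.p r)) ≠ 0 := sub_ne_zero.mpr hne
    simp only [Pi.add_apply, Pi.mul_apply, Pi.inv_apply]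
    field_simp

/-- The map `Π_{𝐱,𝐤} : ℋ_{𝐱,𝐤} → Ω_{𝐱,𝐤}`, `φ ↦ ϕ₀`, picking out the diagonal component. -/
def diagMap (x : Fin N → ℂ) (s : D.lowerSections) (φ : D.H x s) : D.Ωxk x s :=
  ⟨entry 0 0 φ.1, D.diag_mem x s φ.2⟩

/-- The quadratic differential `q` is the product `s ψ` of a section `s` of `K L⁻² Λ` and a section
`ψ` of `K L² Λ⁻¹`. -/
def IsProduct (s : D.lowerSections) (ψ : D.upperSections) (q : TangentFun X) : Prop :=
  ∀ i, ∀ y ∈ D.cover i, ∀ v, q y v = s.1 i y v * ψ.1 i y v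

end RefData

end HiggsDifferential

end

/-!
The transition functions of `L⁻² Λ` and `L² Λ⁻¹` are inverse to each other, so the product of `s`
with a section of `K L² Λ⁻¹` is a quadratic differential on `X`; orders of vanishing add up, so
the product lies in `Q_{-𝐮}`. Since `X` is connected and `s ≠ 0`,
the identity theorem (`RefData.ordAt_ne_top`) shows that all zeros of `s` have finite order, hence
are isolated. So `s` can be cancelled on punctured neighbourhoods, and relations between holomorphic
differentials extend to the centre by continuity (`eq_mul_of_eventually`): this gives injectivity.
For surjectivity, a quadratic differential with divisor at least `𝐮` is divided by `s` in every
local frame (`exists_holDiff_mul_eq`); the quotients are holomorphic and satisfy the transition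
relations away from the zeros of `s`, hence everywhere.

A trace-free matrix is determined by its lower left, diagonal and upper right entries. Two Higgs
differentials in the same fibre of the diagonal map therefore differ by a strictly upper triangular
Higgs field, and the upper right entry of such a field transforms exactly like a section of
`K L² Λ⁻¹` (`RefData.conj_upper`). Hence `H⁰(K L² Λ⁻¹)` acts simply transitively on the fibre, and
the isomorphism with `Q_{-𝐮}` transports this action (`RefData.fibreTorsor`).
-/

open scoped Manifold ContDiff Topology

noncomputable section

namespace HiggsDifferential

section LocalTheory

/-! ### Differentials in local coordinates -/

/-- If `f` vanishes at `a` at least to the order of `g`, and that order is finite, then `f / g` is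
analytic at `a`. -/
lemma exists_analyticAt_eventuallyEq_mul {f g : ℂ → ℂ} {a : ℂ} (hf : AnalyticAt ℂ f a)
    (hg : AnalyticAt ℂ g a) (hfg : analyticOrderAt g a ≤ analyticOrderAt f a)
    (hg' : analyticOrderAt g a ≠ ⊤) :
    ∃ h : ℂ → ℂ, AnalyticAt ℂ h a ∧ f =ᶠ[𝓝 a] g * h := by
  obtain ⟨n, hn⟩ := ENat.ne_top_iff_exists.mp hg'
  obtain ⟨g₁, hg₁, hg₁0, hge⟩ := (hg.analyticOrderAt_eq_natCast).mp hn.symm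
  obtain ⟨f₁, hf₁, hfe⟩ := (natCast_le_analyticOrderAt hf).mp (hn ▸ hfg)
  refine ⟨f₁ / g₁, hf₁.div hg₁ hg₁0, ?_⟩
  filter_upwards [hge, hfe, hg₁.continuousAt.eventually_ne hg₁0] with z h1 h2 h3
  simp only [Pi.mul_apply, Pi.div_apply, h1, h2, smul_eq_mul]
  field_simp

variable {X : Type*} [TopologicalSpace X]

/-- A property that holds on a punctured neighbourhood of a point holds on a punctured
neighbourhood in any local coordinate. -/
lemma eventually_symm {e : OpenPartialHomeomorph X ℂ} {x : X} (hx : x ∈ e.source) {p : X → Prop}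
    (h : ∀ᶠ y in 𝓝[≠] x, p y) : ∀ᶠ z in 𝓝[≠] (e x), p (e.symm z) := by
  rw [eventually_nhdsWithin_iff] at h ⊢
  filter_upwards [(e.eventually_nhds' _ hx).mpr h, e.open_target.mem_nhds (e.map_source hx)]
    with z hz hzt hne
  exact hz fun h => hne (by rw [Set.mem_singleton_iff, ← e.right_inv hzt, h])

lemma eventually_of_symm {e : OpenPartialHomeomorph X ℂ} {x : X} (hx : x ∈ e.source)
    {p : X → Prop} (h : ∀ᶠ z in 𝓝[≠] (e x), p (e.symm z)) : ∀ᶠ y in 𝓝[≠] x, p y := by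
  rw [eventually_nhdsWithin_iff] at h ⊢
  filter_upwards [(e.eventually_nhds _ hx).mp h, e.open_source.mem_nhds hx] with y hy hys hne
  have := hy fun h => hne (e.injOn hys hx h)
  rwa [e.left_inv hys] at this

variable [ChartedSpace ℂ X]

/-- The differential `dz` of the local coordinate given by `e`, at the point `x`. -/
def dcoord (e : OpenPartialHomeomorph X ℂ) (x : X) (v : TangentSpace 𝓘(ℂ) x) : ℂ :=
  mfderiv 𝓘(ℂ) 𝓘(ℂ) e x v

lemma dcoord_smul (e : OpenPartialHomeomorph X ℂ) (x : X) (c : ℂ) (v : TangentSpace 𝓘(ℂ) x) :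
    dcoord e x (c • v) = c * dcoord e x v :=
  (mfderiv 𝓘(ℂ) 𝓘(ℂ) e x).map_smul c v

lemma chart_mdifferentiable {e : OpenPartialHomeomorph X ℂ}
    (he : e ∈ IsManifold.maximalAtlas 𝓘(ℂ) ω X) : e.MDifferentiable 𝓘(ℂ) 𝓘(ℂ) :=
  ⟨(contMDiffOn_of_mem_maximalAtlas he).mdifferentiableOn (by simp),
    (contMDiffOn_symm_of_mem_maximalAtlas he).mdifferentiableOn (by simp)⟩

/-- `dz (∂ / ∂z) = 1`. -/
lemma dcoord_symm {e : OpenPartialHomeomorph X ℂ}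
    (he : e ∈ IsManifold.maximalAtlas 𝓘(ℂ) ω X) {z : ℂ} (hz : z ∈ e.target) :
    dcoord e (e.symm z) (mfderiv 𝓘(ℂ) 𝓘(ℂ) e.symm z (1 : ℂ)) = 1 := by
  have h := (chart_mdifferentiable he).comp_symm_deriv hz
  have := congrArg (fun L => L (1 : ℂ)) h
  exact this

/-- `η = f dz ^ k` where `f` is the coefficient of `η` in the local coordinate `z`. -/
lemma apply_eq_dcoord_pow_mul_coeff {k : ℕ} {η : TangentFun X}
    (hη : ∀ x (c : ℂ) (v : TangentSpace 𝓘(ℂ) x), η x (c • v) = c ^ k * η x v)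
    {e : OpenPartialHomeomorph X ℂ} (he : e ∈ IsManifold.maximalAtlas 𝓘(ℂ) ω X) {x : X}
    (hx : x ∈ e.source) (v : TangentSpace 𝓘(ℂ) x) :
    η x v = dcoord e x v ^ k * coeff e η (e x) := by
  have key : ∀ z ∈ e.target, ∀ v : TangentSpace 𝓘(ℂ) (e.symm z),
      η (e.symm z) v = dcoord e (e.symm z) v ^ k * coeff e η z := by
    intro z hz v
    have h := (chart_mdifferentiable he).symm_comp_deriv (e.map_target hz)
    rw [e.right_inv hz] at h
    have h1 : mfderiv 𝓘(ℂ) 𝓘(ℂ) e.symm z (dcoord e (e.symm z) v) = v :=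
      congrArg (fun L => L v) h
    have h2 : v = dcoord e (e.symm z) v • mfderiv 𝓘(ℂ) 𝓘(ℂ) e.symm z (1 : ℂ) := by
      conv_lhs => rw [← h1]
      have := (mfderiv 𝓘(ℂ) 𝓘(ℂ) e.symm z).map_smul (dcoord e (e.symm z) v) (1 : ℂ)
      rw [← this]
      congr 1
      exact (mul_one (dcoord e (e.symm z) v)).symm
    conv_lhs => rw [h2]
    exact hη _ _ _
  have h := key (e x) (e.map_source hx)
  rw [e.left_inv hx] at h
  exact h v

/-- Analyticity of the coefficient of a `k`-differential does not depend on the local coordinate: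
a change of coordinate multiplies it by the `k`-th power of the derivative. -/
lemma analyticAt_coeff_of_analyticAt_coeff {k : ℕ} {η : TangentFun X}
    (hη : ∀ x (c : ℂ) (v : TangentSpace 𝓘(ℂ) x), η x (c • v) = c ^ k * η x v)
    {e e' : OpenPartialHomeomorph X ℂ} (he : e ∈ IsManifold.maximalAtlas 𝓘(ℂ) ω X)
    (he' : e' ∈ IsManifold.maximalAtlas 𝓘(ℂ) ω X) {x : X}
    (hx : x ∈ e.source) (hx' : x ∈ e'.source) (h : AnalyticAt ℂ (coeff e' η) (e' x)) :
    AnalyticAt ℂ (coeff e η) (e x) := by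
  have htr : AnalyticAt ℂ (e' ∘ e.symm) (e x) := by
    have h1 : ContMDiffAt 𝓘(ℂ) 𝓘(ℂ) ω (e' ∘ e.symm) (e x) := by
      have h2 := contMDiffAt_symm_of_mem_maximalAtlas he (e.map_source hx)
      refine ContMDiffAt.comp (I' := 𝓘(ℂ)) (e x) ?_ h2
      rw [e.left_inv hx]
      exact contMDiffAt_of_mem_maximalAtlas he' hx'
    exact (contMDiffAt_iff_contDiffAt.mp h1).analyticAt
  have hcomp : AnalyticAt ℂ (fun z => coeff e' η ((e' ∘ e.symm) z)) (e x) := by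
    refine AnalyticAt.fun_comp ?_ htr
    simpa [e.left_inv hx] using h
  refine ((htr.deriv.pow k).mul hcomp).congr ?_
  filter_upwards [e.open_target.mem_nhds (e.map_source hx),
    (e.eventually_nhds' _ hx).mpr (e'.open_source.mem_nhds hx')] with z hz hz'
  have h1 := apply_eq_dcoord_pow_mul_coeff hη he' hz' (mfderiv 𝓘(ℂ) 𝓘(ℂ) e.symm z (1 : ℂ))
  have h2 : dcoord e' (e.symm z) (mfderiv 𝓘(ℂ) 𝓘(ℂ) e.symm z (1 : ℂ))
      = deriv (e' ∘ e.symm) z := by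
    rw [← fderiv_apply_one_eq_deriv, ← mfderiv_eq_fderiv, mfderiv_comp z
      ((chart_mdifferentiable he').mdifferentiableAt hz')
      ((chart_mdifferentiable he).mdifferentiableAt_symm hz)]
    rfl
  simp only [Pi.mul_apply, Pi.pow_apply, Function.comp_apply]
  rw [← h2]
  exact h1.symm

/-- Nonvanishing of a differential at a point can be tested on any nonzero tangent vector. -/
lemma apply_ne_zero {k : ℕ} {η : TangentFun X}
    (hη : ∀ x (c : ℂ) (v : TangentSpace 𝓘(ℂ) x), η x (c • v) = c ^ k * η x v)
    {e : OpenPartialHomeomorph X ℂ} (he : e ∈ IsManifold.maximalAtlas 𝓘(ℂ) ω X) {x : X}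
    (hx : x ∈ e.source) {v w : TangentSpace 𝓘(ℂ) x} (hv : η x v ≠ 0) (hw : dcoord e x w ≠ 0) :
    η x w ≠ 0 := by
  rw [apply_eq_dcoord_pow_mul_coeff hη he hx] at hv ⊢
  exact mul_ne_zero (pow_ne_zero _ hw) (right_ne_zero_of_mul hv)

variable [IsManifold 𝓘(ℂ) ω X]

lemma analyticAt_coeff_chartAt {k : ℕ} {U : Set X} {η : TangentFun X} (hη : η ∈ holDiff k U)
    {x : X} (hx : x ∈ U) : AnalyticAt ℂ (coeff (chartAt ℂ x) η) (chartAt ℂ x x) :=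
  hη.2.1 x hx _ (IsManifold.chart_mem_maximalAtlas x) (mem_chart_source ℂ x)

/-- Holomorphy of a differential can be checked in one local coordinate at each point. -/
lemma mem_holDiff {k : ℕ} {U : Set X} {η : TangentFun X}
    (hη : ∀ x (c : ℂ) (v : TangentSpace 𝓘(ℂ) x), η x (c • v) = c ^ k * η x v)
    (h : ∀ x ∈ U, AnalyticAt ℂ (coeff (chartAt ℂ x) η) (chartAt ℂ x x))
    (h0 : ∀ x ∉ U, ∀ v, η x v = 0) : η ∈ holDiff k U :=
  ⟨hη, fun x hx _ he hxe => analyticAt_coeff_of_analyticAt_coeff hη he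
    (IsManifold.chart_mem_maximalAtlas x) hxe (mem_chart_source ℂ x) (h x hx), h0⟩

/-- A linear relation between holomorphic differentials extends by continuity from a punctured
neighbourhood to its centre. -/
lemma eq_mul_of_eventually {k : ℕ} {U V : Set X} {η θ : TangentFun X} (hη : η ∈ holDiff k U)
    (hθ : θ ∈ holDiff k V) {x : X} (hU : x ∈ U) (hV : x ∈ V) {f : X → ℂ} (hf : ContinuousAt f x)
    (h : ∀ᶠ y in 𝓝[≠] x, ∀ v, η y v = f y * θ y v) (v : TangentSpace 𝓘(ℂ) x) :
    η x v = f x * θ x v := by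
  have hx := mem_chart_source ℂ x
  have he := IsManifold.chart_mem_maximalAtlas (I := 𝓘(ℂ)) (n := ω) x
  have hfe : ContinuousAt (fun z => f ((chartAt ℂ x).symm z)) (chartAt ℂ x x) := by
    refine ContinuousAt.comp (g := f) ?_
      ((chartAt ℂ x).continuousAt_symm ((chartAt ℂ x).map_source hx))
    rwa [(chartAt ℂ x).left_inv hx]
  have h1 := (ContinuousAt.eventuallyEq_nhds_iff_eventuallyEq_nhdsNE
    (analyticAt_coeff_chartAt hη hU).continuousAt
    (hfe.mul (analyticAt_coeff_chartAt hθ hV).continuousAt)).mp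
    ((eventually_symm hx h).mono fun z hz => hz _)
  have h2 := h1.eq_of_nhds
  simp only [Pi.mul_apply, (chartAt ℂ x).left_inv hx] at h2
  rw [apply_eq_dcoord_pow_mul_coeff hη.1 he hx, apply_eq_dcoord_pow_mul_coeff hθ.1 he hx, h2]
  ring

/-- A holomorphic differential vanishes identically near a point where its order is infinite. -/
lemma eventually_eq_zero_of_ordAt_eq_top {k : ℕ} {U : Set X} {η : TangentFun X}
    (hη : η ∈ holDiff k U) {x : X} (h : ordAt η x = ⊤) : ∀ᶠ y in 𝓝 x, ∀ v, η y v = 0 := by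
  have hx := mem_chart_source ℂ x
  have h1 := ((chartAt ℂ x).eventually_nhds _ hx).mp (analyticOrderAt_eq_top.mp h)
  filter_upwards [h1, (chartAt ℂ x).open_source.mem_nhds hx] with y hy hys v
  rw [apply_eq_dcoord_pow_mul_coeff hη.1 (IsManifold.chart_mem_maximalAtlas x) hys, hy, mul_zero]

/-- Zeros of finite order are isolated. -/
lemma eventually_ne_zero_of_ordAt_ne_top {k : ℕ} {U : Set X} {η : TangentFun X}
    (hη : η ∈ holDiff k U) {x : X} (hx : x ∈ U) (h : ordAt η x ≠ ⊤) :
    ∀ᶠ y in 𝓝[≠] x, ∃ v, η y v ≠ 0 := by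
  refine eventually_of_symm (mem_chart_source ℂ x) ?_
  have h1 := (analyticAt_coeff_chartAt hη hx).eventually_eq_zero_or_eventually_ne_zero.resolve_left
    fun h' => h (analyticOrderAt_eq_top.mpr h')
  exact h1.mono fun z hz => ⟨_, hz⟩

/-- The order of a product of differentials. -/
lemma ordAt_eq_add {k l : ℕ} {U V : Set X} {η θ q : TangentFun X} (hη : η ∈ holDiff k U)
    (hθ : θ ∈ holDiff l V) {x : X} (hU : x ∈ U) (hV : x ∈ V)
    (h : ∀ᶠ y in 𝓝 x, ∀ v, q y v = η y v * θ y v) : ordAt q x = ordAt η x + ordAt θ x := by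
  have h1 : coeff (chartAt ℂ x) q =ᶠ[𝓝 (chartAt ℂ x x)]
      coeff (chartAt ℂ x) η * coeff (chartAt ℂ x) θ :=
    (((chartAt ℂ x).eventually_nhds' _ (mem_chart_source ℂ x)).mpr h).mono fun z hz => hz _
  rw [ordAt, analyticOrderAt_congr h1,
    analyticOrderAt_mul (analyticAt_coeff_chartAt hη hU) (analyticAt_coeff_chartAt hθ hV)]
  rfl

/-- A common factor that is a differential with isolated zeros can be cancelled on punctured
neighbourhoods. -/
lemma eventually_eq_mul_of_mul_eq {k l : ℕ} {U : Set X} {σ η θ : TangentFun X} {f : X → ℂ}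
    (hσ : σ ∈ holDiff k U)
    (hη : ∀ x (c : ℂ) (v : TangentSpace 𝓘(ℂ) x), η x (c • v) = c ^ l * η x v)
    (hθ : ∀ x (c : ℂ) (v : TangentSpace 𝓘(ℂ) x), θ x (c • v) = c ^ l * θ x v)
    {x : X} (hx : x ∈ U) (hσx : ordAt σ x ≠ ⊤)
    (h : ∀ᶠ y in 𝓝[≠] x, ∀ v, σ y v * η y v = f y * (σ y v * θ y v)) :
    ∀ᶠ y in 𝓝[≠] x, ∀ v, η y v = f y * θ y v := by
  have he := IsManifold.chart_mem_maximalAtlas (I := 𝓘(ℂ)) (n := ω) x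
  filter_upwards [h, eventually_ne_zero_of_ordAt_ne_top hσ hx hσx,
    nhdsWithin_le_nhds (chart_source_mem_nhds ℂ x)] with y hy hne hys v
  obtain ⟨w, hw⟩ := hne
  -- the unit tangent vector `∂ / ∂z`
  obtain ⟨u, hu⟩ : ∃ u, dcoord (chartAt ℂ x) y u = 1 := by
    have := dcoord_symm he ((chartAt ℂ x).map_source hys)
    rw [(chartAt ℂ x).left_inv hys] at this
    exact ⟨_, this⟩
  have h1 := apply_ne_zero hσ.1 he hys hw (w := u) (by rw [hu]; exact one_ne_zero)
  have h2 : η y u = f y * θ y u := mul_left_cancel₀ h1 (by rw [hy u]; ring)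
  rw [apply_eq_dcoord_pow_mul_coeff hη he hys, apply_eq_dcoord_pow_mul_coeff hθ he hys, hu] at h2
  rw [apply_eq_dcoord_pow_mul_coeff hη he hys, apply_eq_dcoord_pow_mul_coeff hθ he hys]
  linear_combination dcoord (chartAt ℂ x) y v ^ l * h2

/-- Division of differentials: if `q` vanishes at every point of `U` at least to the order of `σ`,
and `σ` has isolated zeros, then `q / σ` is holomorphic on `U`. -/
lemma exists_holDiff_mul_eq {k l : ℕ} {U : Set X} (hU : IsOpen U) {σ q : TangentFun X}
    (hσ : σ ∈ holDiff k U)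
    (hq : ∀ x (c : ℂ) (v : TangentSpace 𝓘(ℂ) x), q x (c • v) = c ^ (k + l) * q x v)
    (hqa : ∀ x ∈ U, AnalyticAt ℂ (coeff (chartAt ℂ x) q) (chartAt ℂ x x))
    (hord : ∀ x ∈ U, ordAt σ x ≤ ordAt q x) (htop : ∀ x ∈ U, ordAt σ x ≠ ⊤) :
    ∃ ψ ∈ holDiff l U, ∀ x ∈ U, ∀ v, q x v = σ x v * ψ x v := by
  classical
  have he := fun x : X => IsManifold.chart_mem_maximalAtlas (I := 𝓘(ℂ)) (n := ω) x
  have hex : ∀ x : U, ∃ h : ℂ → ℂ, AnalyticAt ℂ h (chartAt ℂ x.1 x) ∧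
      coeff (chartAt ℂ x.1) q =ᶠ[𝓝 (chartAt ℂ x.1 x)] coeff (chartAt ℂ x.1) σ * h := fun x =>
    exists_analyticAt_eventuallyEq_mul (hqa x x.2) (analyticAt_coeff_chartAt hσ x.2)
      (hord x x.2) (htop x x.2)
  choose h ha heq using hex
  -- the value of `q / σ` at each point is read off from the local quotient centred there
  let ψ : TangentFun X := fun x v =>
    if hx : x ∈ U then dcoord (chartAt ℂ x) x v ^ l * h ⟨x, hx⟩ (chartAt ℂ x x) else 0
  have hψ : ∀ x (c : ℂ) (v : TangentSpace 𝓘(ℂ) x), ψ x (c • v) = c ^ l * ψ x v := by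
    intro x c v
    by_cases hx : x ∈ U
    · simp only [ψ, hx, dif_pos, dcoord_smul]; ring
    · simp [ψ, hx]
  have hmul : ∀ x ∈ U, ∀ v, q x v = σ x v * ψ x v := by
    intro x hx v
    have h1 := (heq ⟨x, hx⟩).eq_of_nhds
    rw [apply_eq_dcoord_pow_mul_coeff hq (he x) (mem_chart_source ℂ x),
      apply_eq_dcoord_pow_mul_coeff hσ.1 (he x) (mem_chart_source ℂ x)]
    simp only [ψ, hx, dif_pos]
    rw [h1, Pi.mul_apply]
    ring
  refine ⟨ψ, mem_holDiff hψ (fun x hx => ?_) (fun x hx v => by simp [ψ, hx]), hmul⟩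
  refine (ha ⟨x, hx⟩).congr ?_
  have hx' := mem_chart_source ℂ x
  have hσ0 := (analyticAt_coeff_chartAt hσ hx).eventually_eq_zero_or_eventually_ne_zero.resolve_left
    fun h' => htop x hx (analyticOrderAt_eq_top.mpr h')
  rw [eventually_nhdsWithin_iff] at hσ0
  filter_upwards [hσ0, heq ⟨x, hx⟩, ((chartAt ℂ x).eventually_nhds' _ hx').mpr (hU.mem_nhds hx)]
    with z hz hze hzU
  by_cases hzx : z = chartAt ℂ x x
  · subst hzx
    have h1 : ∀ v, ψ x v = dcoord (chartAt ℂ x) x v ^ l * h ⟨x, hx⟩ (chartAt ℂ x x) :=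
      fun v => by simp only [ψ, hx, dif_pos]
    have h2 := dcoord_symm (he x) ((chartAt ℂ x).map_source hx')
    have h3 : coeff (chartAt ℂ x) ψ (chartAt ℂ x x) =
        dcoord (chartAt ℂ x) ((chartAt ℂ x).symm (chartAt ℂ x x))
          (mfderiv 𝓘(ℂ) 𝓘(ℂ) (chartAt ℂ x).symm (chartAt ℂ x x) (1 : ℂ)) ^ l *
          h ⟨x, hx⟩ (chartAt ℂ x x) := by
      have h4 : ∀ y, y = x → ∀ v, ψ y v =
          dcoord (chartAt ℂ x) y v ^ l * h ⟨x, hx⟩ (chartAt ℂ x x) := by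
        rintro y rfl; exact h1
      exact h4 _ ((chartAt ℂ x).left_inv hx') _
    rw [h3, h2, one_pow, one_mul]
  · have h1 : coeff (chartAt ℂ x) q z = coeff (chartAt ℂ x) σ z * coeff (chartAt ℂ x) ψ z :=
      hmul _ hzU _
    exact mul_left_cancel₀ (hz hzx) (by rw [← h1, hze]; rfl)

end LocalTheory

/-! ### The cover and sections of line bundles -/

instance (N m n δ : ℕ) : Finite (Idx N m n δ) :=
  Finite.of_surjective
    (fun a : (Fin N ⊕ Fin m) ⊕ (Fin n ⊕ Fin δ) => Sum.elim (Sum.elim Idx.p Idx.q)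
      (Sum.elim Idx.qc Idx.q0) a) fun
    | .p r => ⟨.inl (.inl r), rfl⟩
    | .q i => ⟨.inl (.inr i), rfl⟩
    | .qc j => ⟨.inr (.inl j), rfl⟩
    | .q0 l => ⟨.inr (.inr l), rfl⟩

namespace RefData

variable {X : Type*} [TopologicalSpace X] [ChartedSpace ℂ X] {N m n δ : ℕ}
  (D : RefData X N m n δ)

lemma isOpen_X0 [T1Space X] : IsOpen D.X0 := by
  have h : D.X0 = (Set.range D.pt)ᶜ := by
    ext y
    simp [X0, eq_comm]
  rw [h]
  exact (Set.finite_range D.pt).isClosed.isOpen_compl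

lemma isOpen_cover [T1Space X] : ∀ i, IsOpen (D.cover i)
  | none => D.isOpen_X0
  | some α => (D.chart α).open_source

/-- A point is either in `X₀` or one of the special points. -/
lemma mem_X0_or (y : X) : y ∈ D.X0 ∨ ∃ α, y = D.pt α := by
  by_cases h : y ∈ D.X0
  · exact Or.inl h
  · simp only [X0, Set.mem_ofPred_eq, not_forall, not_not] at h
    exact Or.inr h

lemma exists_mem_cover (y : X) : ∃ i, y ∈ D.cover i := by
  rcases D.mem_X0_or y with h | ⟨α, rfl⟩
  · exact ⟨none, h⟩
  · exact ⟨some α, D.pt_mem α⟩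

/-- The only special point in the neighbourhood of a special point is that point itself. -/
lemma mem_X0_or_eq_pt {α : Idx N m n δ} {y : X} (hy : y ∈ (D.chart α).source) :
    y ∈ D.X0 ∨ y = D.pt α := by
  rcases D.mem_X0_or y with h | ⟨β, rfl⟩
  · exact Or.inl h
  · by_cases hαβ : α = β
    · exact Or.inr (by rw [hαβ])
    · exact absurd (D.pt_mem β) (Set.disjoint_left.mp (D.disjoint α β hαβ) hy)

lemma eventually_mem_overlap (α : Idx N m n δ) :
    ∀ᶠ y in 𝓝[≠] (D.pt α), y ∈ D.X0 ∩ (D.chart α).source :=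
  eventually_of_symm (D.pt_mem α) ((D.eventually_mem α).mono fun _ h => h.1)

lemma continuousAt_t {α : Idx N m n δ} {y : X} (hy : y ∈ (D.chart α).source) :
    ContinuousAt (D.t α) y :=
  ((D.chart α).continuousAt hy).sub continuousAt_const

lemma gL_ne_zero {α : Idx N m n δ} {y : X} (hy : y ∈ D.X0 ∩ (D.chart α).source) :
    D.gL α y ≠ 0 := by
  have := D.t_ne_zero hy
  cases α <;> simp [gL, this]

lemma gΛ_ne_zero {α : Idx N m n δ} {y : X} (hy : y ∈ D.X0 ∩ (D.chart α).source) :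
    D.gΛ α y ≠ 0 := by
  have := D.t_ne_zero hy
  cases α <;> simp [gΛ, this]

lemma continuousAt_gL {α : Idx N m n δ} {y : X} (hy : y ∈ D.X0 ∩ (D.chart α).source) :
    ContinuousAt (D.gL α) y := by
  have h := D.continuousAt_t hy.2
  cases α with
  | p r => exact continuousAt_const
  | q i => exact h
  | qc j => exact h.inv₀ (D.t_ne_zero hy)
  | q0 l => exact continuousAt_const

lemma continuousAt_gΛ {α : Idx N m n δ} {y : X} (hy : y ∈ D.X0 ∩ (D.chart α).source) :
    ContinuousAt (D.gΛ α) y := by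
  have h := D.continuousAt_t hy.2
  cases α with
  | p r => exact continuousAt_const
  | q i => exact continuousAt_const
  | qc j => exact continuousAt_const
  | q0 l => exact h

variable {D} in
/-- The neighbourhoods of distinct special points are disjoint, so a quantity attached to the sets of
the cover containing `y` is independent of the set as soon as it agrees between `X₀` and each of
these neighbourhoods. -/
lemma eq_of_mem_cover {β : Type*} {y : X} {f : Option (Idx N m n δ) → β}
    (h : ∀ α, y ∈ D.X0 ∩ (D.chart α).source → f (some α) = f none) {i j : Option (Idx N m n δ)}
    (hi : y ∈ D.cover i) (hj : y ∈ D.cover j) : f i = f j := by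
  cases i with
  | none =>
    cases j with
    | none => rfl
    | some b => exact (h b ⟨hi, hj⟩).symm
  | some a =>
    cases j with
    | none => exact h a ⟨hj, hi⟩
    | some b =>
      by_cases hab : a = b
      · rw [hab]
      · exact absurd hj (Set.disjoint_left.mp (D.disjoint a b hab) hi)

variable {D}

lemma lower_ne_zero {α : Idx N m n δ} {y : X} (hy : y ∈ D.X0 ∩ (D.chart α).source) :
    (D.gL α y ^ 2)⁻¹ * D.gΛ α y ≠ 0 :=
  mul_ne_zero (inv_ne_zero (pow_ne_zero _ (D.gL_ne_zero hy))) (D.gΛ_ne_zero hy)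

/-- The transition functions of `L⁻² Λ` and `L² Λ⁻¹` cancel, so that the products of local
representatives agree on overlaps. -/
lemma mul_eq_mul_of_mem_cover (s : D.lowerSections) (ψ : D.upperSections) {y : X}
    {i j : Option (Idx N m n δ)} (hi : y ∈ D.cover i) (hj : y ∈ D.cover j)
    (v : TangentSpace 𝓘(ℂ) y) : s.1 i y v * ψ.1 i y v = s.1 j y v * ψ.1 j y v := by
  refine eq_of_mem_cover (D := D) (f := fun i => s.1 i y v * ψ.1 i y v) (fun α hy => ?_) hi hj
  have h1 := D.gL_ne_zero hy
  have h2 := D.gΛ_ne_zero hy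
  simp only [s.2.2 α y hy v, ψ.2.2 α y hy v]
  field_simp

/-- The product `s ψ`, computed at each point in a local frame of the cover. -/
def product (s : D.lowerSections) (ψ : D.upperSections) : TangentFun X := fun y v =>
  s.1 (D.exists_mem_cover y).choose y v * ψ.1 (D.exists_mem_cover y).choose y v

lemma isProduct_product (s : D.lowerSections) (ψ : D.upperSections) :
    D.IsProduct s ψ (product s ψ) := fun _ y hy v =>
  mul_eq_mul_of_mem_cover s ψ (D.exists_mem_cover y).choose_spec hy v

lemma IsProduct.eventually_eq [T1Space X] {s : D.lowerSections} {ψ : D.upperSections}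
    {q : TangentFun X} (h : D.IsProduct s ψ q) {i : Option (Idx N m n δ)} {y : X}
    (hy : y ∈ D.cover i) : ∀ᶠ y' in 𝓝 y, ∀ v, q y' v = s.1 i y' v * ψ.1 i y' v :=
  Filter.mem_of_superset ((D.isOpen_cover i).mem_nhds hy) fun y' hy' => h i y' hy'

variable [IsManifold 𝓘(ℂ) ω X]

/-- A section of a line bundle is determined by its restriction to `X₀`. -/
lemma eq_zero_of_none_eq_zero {k : ℕ} {ℓ : Idx N m n δ → X → ℂ}
    {s : Option (Idx N m n δ) → TangentFun X} (hs : s ∈ D.sections k ℓ) (h : s none = 0) :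
    s = 0 := by
  funext i
  cases i with
  | none => exact h
  | some α =>
    have hov : ∀ y ∈ D.X0 ∩ (D.chart α).source, ∀ v, s (some α) y v = 0 := fun y hy v => by
      rw [hs.2 α y hy v, h]; simp
    funext y v
    by_cases hy : y ∈ (D.chart α).source
    · rcases D.mem_X0_or_eq_pt hy with h0 | rfl
      · exact hov y ⟨h0, hy⟩ v
      · have h1 := eq_mul_of_eventually (hs.1 (some α)) (hs.1 (some α)) hy hy
          (f := fun _ => 0) continuousAt_const
          ((D.eventually_mem_overlap α).mono fun y hy v => by rw [hov y hy v, zero_mul]) v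
        simpa using h1
    · exact (hs.1 (some α)).2.2 y hy v

/-- On a connected Riemann surface, the zeros of a nonzero section have finite order: by the
identity theorem, the set of points near which the section vanishes is open and closed. -/
lemma ordAt_ne_top [T1Space X] [PreconnectedSpace X] {k : ℕ} {ℓ : Idx N m n δ → X → ℂ}
    (hℓ : ∀ α, ∀ y ∈ D.X0 ∩ (D.chart α).source, ℓ α y ≠ 0)
    {s : Option (Idx N m n δ) → TangentFun X} (hs : s ∈ D.sections k ℓ) (hs0 : s ≠ 0)
    {i : Option (Idx N m n δ)} {y : X} (hy : y ∈ D.cover i) : ordAt (s i) y ≠ ⊤ := by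
  -- the vanishing of `s` at a point of `X₀` can be tested in every local frame
  have hiff : ∀ i, ∀ y ∈ D.X0 ∩ D.cover i, ((∀ v, s i y v = 0) ↔ ∀ v, s none y v = 0) := by
    intro i y hy
    cases i with
    | none => rfl
    | some α => simp only [hs.2 α y hy, mul_eq_zero, hℓ α y hy, false_or]
  have hX0 : ∀ i, ∀ y ∈ D.cover i, ∀ᶠ y' in 𝓝[≠] y, y' ∈ D.X0 ∩ D.cover i := by
    intro i y hy
    rcases D.mem_X0_or y with h | ⟨α, rfl⟩
    · exact nhdsWithin_le_nhds
        (Filter.inter_mem (D.isOpen_X0.mem_nhds h) ((D.isOpen_cover i).mem_nhds hy))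
    · filter_upwards [D.eventually_mem_overlap α,
        nhdsWithin_le_nhds ((D.isOpen_cover i).mem_nhds hy)] with y' h1 h2 using ⟨h1.1, h2⟩
  let A : Set X := {y | ∀ᶠ y' in 𝓝 y, ∀ v, s none y' v = 0}
  have hAopen : IsOpen A := isOpen_iff_mem_nhds.mpr fun y hy => eventually_eventually_nhds.mpr hy
  -- infinite order in some frame at `y` forces `y ∈ A`
  have htop : ∀ i, ∀ y ∈ D.cover i, ordAt (s i) y = ⊤ → y ∈ A := by
    intro i y hy h
    have h1 := eventually_eq_zero_of_ordAt_eq_top (hs.1 i) h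
    have h2 : ∀ᶠ y' in 𝓝[≠] y, ∀ v, s none y' v = 0 := by
      filter_upwards [nhdsWithin_le_nhds h1, hX0 i y hy] with y' h3 h4
      exact (hiff i y' h4).mp h3
    have h3 : ∀ v, s none y v = 0 := by
      rcases D.mem_X0_or y with h4 | ⟨α, rfl⟩
      · exact (hiff i y ⟨h4, hy⟩).mp h1.self_of_nhds
      · exact (hs.1 none).2.2 _ fun h5 => h5 α rfl
    rw [eventually_nhdsWithin_iff] at h2
    refine h2.mono fun y' h4 => ?_
    by_cases h5 : y' = y
    · subst h5; exact h3
    · exact h4 h5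
  have hAclosed : IsClosed A := by
    rw [← isOpen_compl_iff, isOpen_iff_mem_nhds]
    intro y hyA
    obtain ⟨i, hi⟩ := D.exists_mem_cover y
    have h1 : ∀ᶠ y' in 𝓝[≠] y, y' ∉ A := by
      filter_upwards [eventually_ne_zero_of_ordAt_ne_top (hs.1 i) hi fun h => hyA (htop i y hi h),
        hX0 i y hi] with y' h2 h3 h4
      obtain ⟨v, hv⟩ := h2
      exact hv ((hiff i y' h3).mpr (Filter.Eventually.self_of_nhds h4) v)
    rw [eventually_nhdsWithin_iff] at h1
    refine h1.mono fun y' h4 => ?_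
    by_cases h5 : y' = y
    · subst h5; exact hyA
    · exact h4 h5
  rcases isClopen_iff.mp ⟨hAclosed, hAopen⟩ with h | h
  · intro h1
    have := htop i y hy h1
    rw [h] at this
    exact this
  · refine absurd (eq_zero_of_none_eq_zero hs ?_) hs0
    funext y v
    have hy : y ∈ A := h ▸ Set.mem_univ y
    exact Filter.Eventually.self_of_nhds hy v

/-! ### Multiplication by a section -/

lemma product_mem_quadDiff [T1Space X] (s : D.lowerSections) (ψ : D.upperSections) :
    product s ψ ∈ quadDiff (D.zeroDivisor s.1) := by
  refine ⟨mem_holDiff (fun y c v => ?_) (fun y _ => ?_) fun y hy => absurd trivial hy,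
    Or.inr fun y => iSup_le fun i => ?_⟩
  · simp only [product, (s.2.1 _).1 y c v, (ψ.2.1 _).1 y c v]
    ring
  · obtain ⟨i, hi⟩ := D.exists_mem_cover y
    refine ((analyticAt_coeff_chartAt (s.2.1 i) hi).mul
      (analyticAt_coeff_chartAt (ψ.2.1 i) hi)).congr ?_
    exact (((chartAt ℂ y).eventually_nhds' _ (mem_chart_source ℂ y)).mpr
      ((isProduct_product s ψ).eventually_eq hi)).mono fun z hz => (hz _).symm
  · rw [ordAt_eq_add (s.2.1 i) (ψ.2.1 i) i.2 i.2 ((isProduct_product s ψ).eventually_eq i.2)]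
    exact le_self_add

/-- Multiplication by `s` as a linear map `H⁰(K L² Λ⁻¹) → Q_{-𝐮}`. -/
def mulHom [T1Space X] (s : D.lowerSections) :
    D.upperSections →ₗ[ℂ] quadDiff (D.zeroDivisor s.1) where
  toFun ψ := ⟨product s ψ, product_mem_quadDiff s ψ⟩
  map_add' ψ ψ' := Subtype.ext <| by
    funext y v
    exact mul_add _ _ _
  map_smul' c ψ := Subtype.ext <| by
    funext y v
    exact mul_left_comm _ _ _

lemma mulHom_injective [T1Space X] [PreconnectedSpace X] {s : D.lowerSections} (hs : s ≠ 0) :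
    Function.Injective (mulHom s) := by
  rw [← LinearMap.ker_eq_bot, LinearMap.ker_eq_bot']
  intro ψ hψ
  have hs' : s.1 ≠ 0 := fun h => hs (Subtype.ext h)
  refine Subtype.ext (eq_zero_of_none_eq_zero ψ.2 ?_)
  funext y v
  by_cases hy : y ∈ D.cover none
  · have h0 : ∀ᶠ y' in 𝓝[≠] y, ∀ v, s.1 none y' v * ψ.1 none y' v
        = (fun _ => 0) y' * (s.1 none y' v * ψ.1 none y' v) := by
      refine nhdsWithin_le_nhds (((isProduct_product s ψ).eventually_eq hy).mono fun y' h v => ?_)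
      have h1 : product s ψ y' v = 0 := congrFun (congrFun (congrArg Subtype.val hψ) y') v
      rw [← h v, h1, zero_mul]
    have h1 := eq_mul_of_eventually (ψ.2.1 none) (ψ.2.1 none) hy hy continuousAt_const
      (eventually_eq_mul_of_mul_eq (s.2.1 none) (ψ.2.1 none).1 (ψ.2.1 none).1 hy
        (ordAt_ne_top (fun _ _ h => lower_ne_zero h) s.2 hs' hy) h0) v
    rw [h1, zero_mul]; rfl
  · exact (ψ.2.1 none).2.2 y hy v

lemma mulHom_surjective [T1Space X] [PreconnectedSpace X] {s : D.lowerSections} (hs : s ≠ 0) :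
    Function.Surjective (mulHom s) := by
  rintro ⟨q, hq, hqD⟩
  have hs' : s.1 ≠ 0 := fun h => hs (Subtype.ext h)
  have htop : ∀ i, ∀ y ∈ D.cover i, ordAt (s.1 i) y ≠ ⊤ := fun i y hy =>
    ordAt_ne_top (fun _ _ h => lower_ne_zero h) s.2 hs' hy
  have hord : ∀ i, ∀ y ∈ D.cover i, ordAt (s.1 i) y ≤ ordAt q y := by
    intro i y hy
    rcases hqD with rfl | h
    · have : ordAt (0 : TangentFun X) y = ⊤ := analyticOrderAt_eq_top.mpr (.of_forall fun _ => rfl)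
      rw [this]
      exact le_top
    · exact (le_iSup (fun i : {i // y ∈ D.cover i} => ordAt (s.1 i) y) ⟨i, hy⟩).trans (h y)
  choose ψ hψ hmul using fun i => exists_holDiff_mul_eq (k := 1) (l := 1) (D.isOpen_cover i)
    (s.2.1 i) hq.1 (fun y _ => analyticAt_coeff_chartAt hq trivial) (hord i) (htop i)
  have hψmem : ψ ∈ D.upperSections := by
    refine ⟨hψ, fun α y hy v => ?_⟩
    -- away from the zeros of `s` the relation follows by cancelling `s`
    refine eq_mul_of_eventually (f := fun y => D.gL α y ^ 2 * (D.gΛ α y)⁻¹) (hψ (some α)) (hψ none)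
      hy.2 hy.1 (((D.continuousAt_gL hy).pow 2).mul
        ((D.continuousAt_gΛ hy).inv₀ (D.gΛ_ne_zero hy))) ?_ v
    refine eventually_eq_mul_of_mul_eq (s.2.1 (some α)) (hψ (some α)).1 (hψ none).1 hy.2
      (htop (some α) y hy.2) (nhdsWithin_le_nhds ?_)
    filter_upwards [(D.isOpen_X0.inter (D.chart α).open_source).mem_nhds hy] with y' hy' w
    have h1 := D.gL_ne_zero hy'
    have h2 := D.gΛ_ne_zero hy'
    rw [← hmul (some α) y' hy'.2, hmul none y' hy'.1, s.2.2 α y' hy' w]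
    field_simp
  refine ⟨⟨ψ, hψmem⟩, Subtype.ext ?_⟩
  funext y v
  obtain ⟨i, hi⟩ := D.exists_mem_cover y
  exact (isProduct_product s ⟨ψ, hψmem⟩ i y hi v).trans (hmul i y hi v).symm

/-- Multiplication by `s ≠ 0` as a linear isomorphism `H⁰(K L² Λ⁻¹) ≃ Q_{-𝐮}`. -/
def mulEquiv [T1Space X] [PreconnectedSpace X] {s : D.lowerSections} (hs : s ≠ 0) :
    D.upperSections ≃ₗ[ℂ] quadDiff (D.zeroDivisor s.1) :=
  LinearEquiv.ofBijective (mulHom s) ⟨mulHom_injective hs, mulHom_surjective hs⟩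

end RefData

namespace RefData

variable {X : Type*} [TopologicalSpace X] [ChartedSpace ℂ X] {N m n δ : ℕ}
  {D : RefData X N m n δ}

/-! ### Higgs differentials with the same lower left and diagonal components -/

/-- Strictly upper triangular matrices transform like sections of `K L² Λ⁻¹`. -/
lemma conj_upper (x : Fin N → ℂ) (α : Idx N m n δ) {y : X}
    (hy : y ∈ D.X0 ∩ (D.chart α).source) (a : ℂ) :
    D.gE x α y * !![0, a; 0, 0] * (D.gE x α y)⁻¹ =
      !![0, D.gL α y ^ 2 * (D.gΛ α y)⁻¹ * a; 0, 0] := by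
  have ht := D.t_ne_zero hy
  cases α <;> ext i j <;> fin_cases i <;> fin_cases j <;>
    simp [gE, gL, gΛ, Matrix.inv_def, Matrix.adjugate_fin_two, Matrix.mul_apply,
      Fin.sum_univ_two, Matrix.det_fin_two, ht] <;>
    try field_simp

/-- A section of `K L² Λ⁻¹` is a strictly upper triangular Higgs field. -/
lemma upperRight_mem_higgsFields (x : Fin N → ℂ) (ψ : D.upperSections) :
    (fun i => upperRight (ψ.1 i)) ∈ D.higgsFields x := by
  refine ⟨fun i a b => ?_, fun i y v => ?_, fun α y hy v => ?_⟩
  · fin_cases a <;> fin_cases b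
    · exact zero_mem (holDiff 1 (D.cover i))
    · exact ψ.2.1 i
    · exact zero_mem (holDiff 1 (D.cover i))
    · exact zero_mem (holDiff 1 (D.cover i))
  · simp [upperRight, Matrix.trace_fin_two]
  · simp only [upperRight]
    rw [conj_upper x α hy, ψ.2.2 α y hy v]

/-- Two Higgs differentials with the same lower left and diagonal components differ by a section
of `K L² Λ⁻¹`. -/
lemma exists_eq_add_upperRight {x : Fin N → ℂ} {φ φ' : TangentMat X}
    (hφ : φ ∈ D.higgsDifferentials x) (hφ' : φ' ∈ D.higgsDifferentials x)
    (h10 : entry 1 0 φ = entry 1 0 φ') (h00 : entry 0 0 φ = entry 0 0 φ') :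
    ∃ ψ : D.upperSections, φ = φ' + upperRight (ψ.1 none) := by
  obtain ⟨Φ, hΦ, hd⟩ := sub_mem hφ hφ'
  have hnone : Φ none = upperRight (entry 0 1 (Φ none)) := by
    change Φ none = φ - φ' at hd
    have hv10 : ∀ y v, Φ none y v 1 0 = 0 := fun y v => by
      rw [hd]; exact sub_eq_zero.mpr (congrFun (congrFun h10 y) v)
    have hv00 : ∀ y v, Φ none y v 0 0 = 0 := fun y v => by
      rw [hd]; exact sub_eq_zero.mpr (congrFun (congrFun h00 y) v)
    funext y v
    have htr := hΦ.2.1 none y v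
    rw [Matrix.trace_fin_two, hv00 y v, zero_add] at htr
    ext a b
    fin_cases a <;> fin_cases b
    · exact hv00 y v
    · rfl
    · exact hv10 y v
    · exact htr
  refine ⟨⟨fun i => entry 0 1 (Φ i), fun i => hΦ.1 i 0 1, fun α y hy v => ?_⟩, ?_⟩
  · have h1 := hΦ.2.2 α y hy v
    rw [hnone] at h1
    simp only [upperRight] at h1
    rw [conj_upper x α hy] at h1
    exact congrFun (congrFun h1 0) 1
  · rw [← hnone]
    exact (add_sub_cancel φ' φ).symm.trans (congrArg (φ' + ·) hd.symm)

lemma add_upperRight_mem_H {x : Fin N → ℂ} {s : D.lowerSections} {φ : TangentMat X}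
    (hφ : φ ∈ D.H x s) (ψ : D.upperSections) : φ + upperRight (ψ.1 none) ∈ D.H x s := by
  refine ⟨add_mem hφ.1 ⟨_, upperRight_mem_higgsFields x ψ, rfl⟩, ?_⟩
  rw [← hφ.2]
  funext y v
  exact add_zero _

lemma upperRight_add (ψ ψ' : TangentFun X) :
    upperRight (ψ + ψ') = upperRight ψ + upperRight ψ' := by
  funext y v
  ext a b
  fin_cases a <;> fin_cases b <;> simp [upperRight]

lemma upperRight_injective : Function.Injective (upperRight (X := X)) := fun ψ ψ' h => by
  funext y v
  exact congrFun (congrFun (congrFun (congrFun h y) v) 0) 1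

/-- The translate by `ψ` of an element of a fibre of the diagonal map. -/
def translate {x : Fin N → ℂ} {s : D.lowerSections} {ω₀ : D.Ωxk x s} (ψ : D.upperSections)
    (φ : D.diagMap x s ⁻¹' {ω₀}) : D.diagMap x s ⁻¹' {ω₀} :=
  ⟨⟨φ.1.1 + upperRight (ψ.1 none), add_upperRight_mem_H φ.1.2 ψ⟩, by
    have h : D.diagMap x s φ.1 = ω₀ := φ.2
    refine Eq.trans (Subtype.ext ?_) h
    funext y v
    exact add_zero _⟩

lemma exists_eq_translate {x : Fin N → ℂ} {s : D.lowerSections} {ω₀ : D.Ωxk x s}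
    (φ φ' : D.diagMap x s ⁻¹' {ω₀}) : ∃ ψ : D.upperSections, φ = translate ψ φ' := by
  have h : D.diagMap x s φ.1 = D.diagMap x s φ'.1 :=
    (show _ = ω₀ from φ.2).trans (show _ = ω₀ from φ'.2).symm
  obtain ⟨ψ, hψ⟩ := exists_eq_add_upperRight φ.1.2.1 φ'.1.2.1 (φ.1.2.2.trans φ'.1.2.2.symm)
    (congrArg Subtype.val h)
  exact ⟨ψ, Subtype.ext (Subtype.ext hψ)⟩

variable [IsManifold 𝓘(ℂ) ω X]

lemma translate_injective {x : Fin N → ℂ} {s : D.lowerSections} {ω₀ : D.Ωxk x s}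
    (φ : D.diagMap x s ⁻¹' {ω₀}) : Function.Injective fun ψ => translate ψ φ := by
  intro ψ ψ' h
  have h1 : φ.1.1 + upperRight (ψ.1 none) = φ.1.1 + upperRight (ψ'.1 none) :=
    congrArg (fun φ : D.diagMap x s ⁻¹' {ω₀} => φ.1.1) h
  have h2 : ψ.1 none = ψ'.1 none := upperRight_injective (add_left_cancel h1)
  exact sub_eq_zero.mp (Subtype.ext (eq_zero_of_none_eq_zero (ψ - ψ').2 (sub_eq_zero.mpr h2)))

/-- A nonempty fibre of the diagonal map is a torsor under any additive group identified with
`H⁰(K L² Λ⁻¹)`. -/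
@[reducible] def fibreTorsor {G : Type*} [AddGroup G] {x : Fin N → ℂ} {s : D.lowerSections} {ω₀ : D.Ωxk x s}
    (hω₀ : ω₀ ∈ Set.range (D.diagMap x s)) (e : D.upperSections ≃+ G) :
    AddTorsor G (D.diagMap x s ⁻¹' {ω₀}) where
  vadd g φ := translate (e.symm g) φ
  zero_vadd φ := by
    refine Subtype.ext (Subtype.ext ?_)
    change φ.1.1 + upperRight ((e.symm 0).1 none) = φ.1.1
    rw [map_zero]
    refine add_eq_left.mpr ?_
    funext y v
    ext a b
    fin_cases a <;> fin_cases b <;> rfl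
  add_vadd g g' φ := by
    refine Subtype.ext (Subtype.ext ?_)
    change φ.1.1 + upperRight ((e.symm (g + g')).1 none) =
      φ.1.1 + upperRight ((e.symm g').1 none) + upperRight ((e.symm g).1 none)
    rw [add_assoc, ← upperRight_add, add_comm ((e.symm g').1 none), map_add]
    rfl
  vsub φ φ' := e (exists_eq_translate φ φ').choose
  nonempty := hω₀.elim fun φ h => ⟨⟨φ, h⟩⟩
  vsub_vadd' φ φ' := by
    change translate (e.symm (e _)) φ' = φ
    rw [e.symm_apply_apply]
    exact (exists_eq_translate φ φ').choose_spec.symm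
  vadd_vsub' g φ := by
    change e (exists_eq_translate (translate (e.symm g) φ) φ).choose = g
    rw [← e.eq_symm_apply]
    exact translate_injective φ (exists_eq_translate (translate (e.symm g) φ) φ).choose_spec.symm

end RefData

end HiggsDifferential

end

open HiggsDifferential in
theorem proposition2p6 {X : Type*} [TopologicalSpace X] [T2Space X] [CompactSpace X]
    [ConnectedSpace X] [ChartedSpace ℂ X] [IsManifold 𝓘(ℂ) ω X]
    {N m n δ : ℕ} (D : RefData X N m n δ) (x : Fin N → ℂ)
    (s : D.lowerSections) (hs : s ∈ LinearMap.range (D.c x)) (hs0 : s ≠ 0)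
    (ω₀ : D.Ωxk x s) (hω₀ : ω₀ ∈ Set.range (D.diagMap x s)) :
    ∃ mulS : D.upperSections ≃ₗ[ℂ] quadDiff (D.zeroDivisor s.1),
      (∀ ψ, D.IsProduct s ψ (mulS ψ).1) ∧
      ∃ _ : AddTorsor (quadDiff (D.zeroDivisor s.1)) (D.diagMap x s ⁻¹' {ω₀}),
        ∀ (ψ : D.upperSections) (φ : D.diagMap x s ⁻¹' {ω₀}),
          (mulS ψ +ᵥ φ).1.1 = φ.1.1 + upperRight (ψ.1 none) := by
  refine ⟨RefData.mulEquiv hs0, fun ψ => RefData.isProduct_product s ψ,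
    RefData.fibreTorsor hω₀ (RefData.mulEquiv hs0).toAddEquiv, fun ψ φ => ?_⟩
  change φ.1.1 + upperRight
    (((RefData.mulEquiv hs0).symm (RefData.mulEquiv hs0 ψ)).1 none) = _
  rw [LinearEquiv.symm_apply_apply]
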